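/- Let $X$ be an alphabet and let $\langle X\mid u=v\rangle$ be an Adian presentation with one relation: $u,v\in X^+$, and neither the left graph (vertex set $X$, one edge joining the first letters of $u$ and $v$) nor the right graph (one edge joining the last letters) contains a cycle, loops included. The words $u,v$ are called the $R$-words. Assume that the presentation is of type (3): neither of $u,v$ is a subword of the other, a nonempty prefix of one of them is a suffix of the other, and no nonempty suffix of the former is a prefix of the latter. Assume also that no $R$-word overlaps with itself, i.e. no nonempty proper prefix of $u$ (of $v$) is a suffix of $u$ (of $v$). Let $w\in X^+$, and fix an occurrence in $w$ of an $R$-word $r$; let $s$ be the other $R$-word. The subgraph $\Delta$ of the Schützenberger graph $S\Gamma(w)$ generated by this occurrence is constructed by elementary expansions, as follows. $\Delta_0$ is the linear automaton of $w$ (a path labelled by $w$). $\Delta_1$ is obtained by sewing on a new segment labelled by $s$ from the initial to the terminal vertex of the given occurrence of $r$. For $n\ge 1$, $\Delta_{n+1}$ is obtained from $\Delta_n$ by sewing on, for all vertices $a,b$ of $\Delta_n$ at least one of which is an interior vertex of a segment sewn on in step $n$, and for each ordering $(p,q)$ of the two $R$-words such that $p$ but not $q$ can be read from $a$ to $b$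 in $\Delta_n$, a new segment labelled by $q$ from $a$ to $b$. Finally $\Delta=\bigcup_n\Delta_n$. A region of $\Delta$ is given by a vertex at which both $u$ and $v$ can be read in $\Delta$; its boundary is the pair of paths labelled by $u$ and $v$ starting at that vertex. Then every region of $\Delta$ has an edge of the linear automaton of $w$ on its boundary. Consequently $\Delta$ is finite: it has finitely many vertices and finitely many edges. -/

import Mathlib

namespace RWordSubgraph

universe u

/-! ### Positive presentations and Adian presentations

Words over the alphabet `X` are lists; a positive presentation is given by a set `R` of pairs of
nonempty words. -/

/-- Undirected walks in the multigraph that has one edge for every relation `ρ ∈ R`, joining the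
letters `f ρ.1` and `f ρ.2`.  With `f = List.head?` this is the left graph of the presentation,
with `f = List.getLast?` the right graph.  The list records the edges that are traversed. -/
inductive LetterWalk {X : Type u} (R : Set (List X × List X)) (f : List X → Option X) :
    Option X → List (List X × List X) → Option X → Prop
  | nil (a : Option X) : LetterWalk R f a [] a
  | forward {ρ : List X × List X} {l : List (List X × List X)} {c : Option X} (h : ρ ∈ R)
      (hl : LetterWalk R f (f ρ.2) l c) : LetterWalk R f (f ρ.1) (ρ :: l) c
  | backward {ρ : List X × List X} {l : List (List X × List X)} {c : Option X} (h : ρ ∈ R)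
      (hl : LetterWalk R f (f ρ.1) l c) : LetterWalk R f (f ρ.2) (ρ :: l) c

/-- There is no cycle: a closed walk that repeats no edge is empty (loops and pairs of parallel
edges are cycles). -/
def CycleFree {X : Type u} (R : Set (List X × List X)) (f : List X → Option X) : Prop :=
  ∀ (a : Option X) (l : List (List X × List X)), LetterWalk R f a l a → l.Nodup → l = []

/-- Adian presentations: positive presentations whose left and right graphs have no cycle. -/
structure IsAdian {X : Type u} (R : Set (List X × List X)) : Prop where
  positive : ∀ ρ ∈ R, ρ.1 ≠ [] ∧ ρ.2 ≠ []
  left_cycleFree : CycleFree R List.head?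
  right_cycleFree : CycleFree R List.getLast?

/-- `r` and `s` are the two sides of a relation of `R`, in one of the two orders. -/
def Sides {X : Type u} (R : Set (List X × List X)) (r s : List X) : Prop :=
  (r, s) ∈ R ∨ (s, r) ∈ R

/-! ### Overlaps -/

/-- A nonempty prefix of `p` is a suffix of `q`. -/
def PrefixMeetsSuffix {X : Type u} (p q : List X) : Prop :=
  ∃ y : List X, y ≠ [] ∧ y <+: p ∧ y <:+ q

/-- A word overlaps with itself if one of its nonempty proper prefixes is also a suffix. -/
def OverlapsItself {X : Type u} (t : List X) : Prop :=
  ∃ y : List X, y ≠ [] ∧ y ≠ t ∧ y <+: t ∧ y <:+ t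

/-- Type (3): neither word is a subword of the other, a prefix of one of them is a suffix of the
other, and no suffix of the former is a prefix of the latter. -/
def IsTypeThree {X : Type u} (p q : List X) : Prop :=
  (¬ p <:+: q ∧ ¬ q <:+: p) ∧
    ((PrefixMeetsSuffix p q ∧ ¬ PrefixMeetsSuffix q p) ∨
      (PrefixMeetsSuffix q p ∧ ¬ PrefixMeetsSuffix p q))

/-! ### Labelled graphs

An inverse word graph is determined by its positively labelled edges `(a, x, b)`, and these are
what is recorded; every such edge is understood together with its inverse `(b, x⁻¹, a)`.  All
segments below carry positive labels, so they run through positive edges only. -/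

/-- `l` is the sequence of edges of a segment from `a` to `b` in the graph with edge set `E`. -/
def IsSegment {V X : Type u} (E : Set (V × X × V)) : V → List (V × X × V) → V → Prop
  | a, [], b => a = b
  | a, e :: l, b => e ∈ E ∧ e.1 = a ∧ IsSegment E e.2.2 l b

/-- The word that labels a sequence of edges. -/
def label {V X : Type u} (l : List (V × X × V)) : List X :=
  l.map fun e => e.2.1

/-- The word `t` can be read from `a` to `b`. -/
def Reads {V X : Type u} (E : Set (V × X × V)) (a : V) (t : List X) (b : V) : Prop :=
  ∃ l, IsSegment E a l b ∧ label l = t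

/-- The vertices of a graph without isolated vertices. -/
def vertexSet {V X : Type u} (E : Set (V × X × V)) : Set V :=
  {a | ∃ e ∈ E, a = e.1 ∨ a = e.2.2}

/-- The edges of the linear graph with label `t` through the points `p 0, p 1, …, p t.length`. -/
def lineEdges {V X : Type u} (p : ℕ → V) (t : List X) : Set (V × X × V) :=
  {e | ∃ (j : ℕ) (h : j < t.length), e = (p j, t[j], p (j + 1))}

/-- A region of the graph `E` over the presentation `R`: the two sides of a relation `(r, s) ∈ R`
can be read at a vertex `start`, and the boundary is the pair of segments so obtained. -/
structure Region {V X : Type u} (R : Set (List X × List X)) (E : Set (V × X × V)) where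
  start : V
  rel : List X × List X
  rel_mem : rel ∈ R
  /-- The terminal vertex and the edges of the segment labelled by `rel.1`. -/
  stop₁ : V
  side₁ : List (V × X × V)
  isSegment₁ : IsSegment E start side₁ stop₁
  label₁ : label side₁ = rel.1
  /-- The terminal vertex and the edges of the segment labelled by `rel.2`. -/
  stop₂ : V
  side₂ : List (V × X × V)
  isSegment₂ : IsSegment E start side₂ stop₂
  label₂ : label side₂ = rel.2

/-- The region has an edge of the graph `L` on its boundary. -/
def Region.UsesEdgeOf {V X : Type u} {R : Set (List X × List X)} {E : Set (V × X × V)}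
    (D : Region R E) (L : Set (V × X × V)) : Prop :=
  ∃ e ∈ L, e ∈ D.side₁ ∨ e ∈ D.side₂

/-! ### The subgraph generated by an occurrence of an `R`-word -/

/-- A supply of vertices: those of the linear automaton, `base 0, base 1, …`, and, for vertices
`a`, `b` and a relation with sides `r` and `s`, the interior vertices
`sewn a b r s j`, `0 < j < s.length`, of a new segment labelled by `s` that is sewn on from `a` to
`b`.  An elementary expansion is performed at most once for given `a b r s` (afterwards `s` can be
read from `a` to `b`), so these vertices are new whenever a segment is sewn on. -/
inductive Vertex (X : Type u) : Type u
  | base (i : ℕ) : Vertex X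
  | sewn (a b : Vertex X) (r s : List X) (j : ℕ) : Vertex X

/-- The linear automaton of `w`, with initial vertex `base 0` and terminal vertex
`base w.length`. -/
def linearAutomaton {X : Type u} (w : List X) : Set (Vertex X × X × Vertex X) :=
  lineEdges Vertex.base w

/-- The data of an elementary expansion: a segment labelled by `s` is sewn on from `a` to `b`,
where `r` can be read from `a` to `b`. -/
structure Sewing (X : Type u) where
  a : Vertex X
  b : Vertex X
  r : List X
  s : List X

/-- The successive vertices of the new segment; those with `0 < j < s.length` are interior. -/
def Sewing.point {X : Type u} (σ : Sewing X) (j : ℕ) : Vertex X :=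
  if j = 0 then σ.a else if j = σ.s.length then σ.b else Vertex.sewn σ.a σ.b σ.r σ.s j

/-- The edges of the new segment. -/
def Sewing.edges {X : Type u} (σ : Sewing X) : Set (Vertex X × X × Vertex X) :=
  lineEdges σ.point σ.s

/-- The interior vertices of the new segment. -/
def Sewing.interior {X : Type u} (σ : Sewing X) : Set (Vertex X) :=
  {a | ∃ j, 0 < j ∧ j < σ.s.length ∧ a = σ.point j}

/-- The elementary expansion `σ` can be performed on the graph `E`: `σ.r` labels an unsaturated
segment from `σ.a` to `σ.b`. -/
def Sewing.Admissible {X : Type u} (R : Set (List X × List X))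
    (E : Set (Vertex X × X × Vertex X)) (σ : Sewing X) : Prop :=
  Sides R σ.r σ.s ∧ Reads E σ.a σ.r σ.b ∧ ¬ Reads E σ.a σ.s σ.b

/-- A graph together with the segments sewn on in the last iterative step. -/
structure Stage (X : Type u) where
  edges : Set (Vertex X × X × Vertex X)
  last : Set (Sewing X)

/-- Sew on all the segments of `S`. -/
def Stage.sew {X : Type u} (T : Stage X) (S : Set (Sewing X)) : Stage X where
  edges := T.edges ∪ ⋃ σ ∈ S, σ.edges
  last := S

/-- The expansions of a general iterative step: all those on unsaturated segments that start from
or terminate at an interior vertex of a segment sewn on in the previous step. -/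
def Stage.next {X : Type u} (R : Set (List X × List X)) (T : Stage X) : Set (Sewing X) :=
  {σ | σ.Admissible R T.edges ∧ ∃ τ ∈ T.last, σ.a ∈ τ.interior ∨ σ.b ∈ τ.interior}

/-- The stages `Δ₀, Δ₁, Δ₂, …` for the occurrence of `r` in `w` that begins after the first `k`
letters of `w`, the other side of the relation being `s`: the linear automaton of `w`; then `s` is
sewn on along that occurrence of `r` only; then the general step is iterated. -/
def stage {X : Type u} (R : Set (List X × List X)) (w r s : List X) (k : ℕ) : ℕ → Stage X
  | 0 => ⟨linearAutomaton w, ∅⟩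
  | 1 => Stage.sew ⟨linearAutomaton w, ∅⟩ {⟨Vertex.base k, Vertex.base (k + r.length), r, s⟩}
  | n + 2 => (stage R w r s k (n + 1)).sew ((stage R w r s k (n + 1)).next R)

/-- The subgraph of the Schützenberger graph of `w` generated by the occurrence of `r` at position
`k`: the limit, that is the union, of the stages. -/
def generatedSubgraph {X : Type u} (R : Set (List X × List X)) (w r s : List X) (k : ℕ) :
    Set (Vertex X × X × Vertex X) :=
  ⋃ n, (stage R w r s k n).edges

/-- `r` occurs in `w` after the first `k` letters. -/
def OccursAt {X : Type u} (r w : List X) (k : ℕ) : Prop :=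
  r <+: w.drop k

end RWordSubgraph

namespace RWordSubgraph

open List

universe u

/-! ### Segments -/

section Segments

variable {V X : Type u} {E : Set (V × X × V)}

/-! Type (3) leaves two mirror cases: no nonempty prefix of `s` is a suffix of `r`, or no nonempty
prefix of `r` is a suffix of `s`. In the first, induction on the step shows that only `s` is ever
sewn on, always along `r`, and always ending on the line of `w`. An interior vertex of a segment
just sewn on has no other edges yet. A path reaching it therefore reads a subword of `s` or ends
with a nonempty proper prefix of `s`; neither `r` nor `s` labels such a path. So every new expansion
starts at such a vertex, and it reads `r`, since `s` does not overlap itself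
(`not_reads_to_interior`, `not_reads_from_interior`). The last edge of any path labelled `r` lies on
the line: otherwise, tracing back along its segment, `r` would be a subword of `s` or would end with
a nonempty prefix of `s` (`exists_concat_of_label`). This settles the claim on regions, one side of
which reads `r`. It also puts the endpoint of each new segment on the line, strictly to the right of
the previous one, so the construction stops. The second case exchanges beginnings and ends. -/

theorem isSegment_append {a b : V} {l₁ l₂ : List (V × X × V)} :
    IsSegment E a (l₁ ++ l₂) b ↔ ∃ c, IsSegment E a l₁ c ∧ IsSegment E c l₂ b := by
  induction l₁ generalizing a with
  | nil => simp [IsSegment]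
  | cons e l ih => simp [IsSegment, ih, and_assoc]

theorem isSegment_concat {a b : V} {l : List (V × X × V)} {e : V × X × V} :
    IsSegment E a (l ++ [e]) b ↔ IsSegment E a l e.1 ∧ e ∈ E ∧ e.2.2 = b := by
  rw [isSegment_append]
  simp only [IsSegment]
  constructor
  · rintro ⟨c, h, he, rfl, hb⟩
    exact ⟨h, he, hb⟩
  · rintro ⟨h, he, hb⟩
    exact ⟨_, h, he, rfl, hb⟩

theorem label_append (l₁ l₂ : List (V × X × V)) :
    label (l₁ ++ l₂) = label l₁ ++ label l₂ := by
  simp [label]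

theorem label_eq_nil {l : List (V × X × V)} : label l = [] ↔ l = [] := by
  simp [label]

/-- A segment that ends on a line whose vertices have no further incoming edges follows the line
backwards. -/
theorem label_suffix_or_suffix {q : ℕ → V} {s : List X} {a : V} (j : ℕ)
    (h : ∀ i < j, ∀ e ∈ E, e.2.2 = q (i + 1) → e.1 = q i ∧ s[i]? = some e.2.1)
    (l : List (V × X × V)) (hl : IsSegment E a l (q j)) :
    label l <:+ s.take j ∨ s.take j <:+ label l := by
  induction j generalizing l with
  | zero => right; simp
  | succ j ih =>
    rcases l.eq_nil_or_concat with rfl | ⟨l, e, rfl⟩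
    · left; simp [label]
    · rw [List.concat_eq_append, isSegment_concat] at hl
      obtain ⟨hl, he, heq⟩ := hl
      obtain ⟨h₁, h₂⟩ := h j (Nat.lt_succ_self j) e he heq
      rw [h₁] at hl
      rw [List.concat_eq_append, label_append, List.take_add_one, h₂]
      rcases ih (fun i hi => h i (Nat.lt_succ_of_lt hi)) l hl with ⟨t, ht⟩ | ⟨t, ht⟩
      · exact Or.inl ⟨t, by rw [← ht]; simp [label]⟩
      · exact Or.inr ⟨t, by rw [← ht]; simp [label]⟩

/-- A segment that starts on a line whose vertices have no further outgoing edges follows the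
line. -/
theorem label_prefix_or_prefix {q : ℕ → V} {s : List X} {b : V} (l : List (V × X × V)) (j : ℕ)
    (h : ∀ i, j ≤ i → i < s.length → ∀ e ∈ E, e.1 = q i →
      e.2.2 = q (i + 1) ∧ s[i]? = some e.2.1)
    (hl : IsSegment E (q j) l b) :
    label l <+: s.drop j ∨ s.drop j <+: label l := by
  induction l generalizing j with
  | nil => left; simp [label]
  | cons e l ih =>
    rcases lt_or_ge j s.length with hj | hj
    · obtain ⟨he, heq, hl⟩ := hl
      obtain ⟨h₁, h₂⟩ := h j le_rfl hj e he heq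
      rw [h₁] at hl
      obtain ⟨hj', h₂⟩ := List.getElem?_eq_some_iff.1 h₂
      rw [List.drop_eq_getElem_cons hj, h₂]
      have hc : label (e :: l) = e.2.1 :: label l := rfl
      rw [hc, List.prefix_cons_inj, List.prefix_cons_inj]
      exact ih (j + 1) (fun i hi => h i (by omega)) hl
    · right; simp [List.drop_eq_nil_of_le hj]

theorem IsSegment.le_of_edges {f : V → ℕ} (hf : ∀ e ∈ E, f e.1 ≤ f e.2.2) {a b : V}
    {l : List (V × X × V)} (hl : IsSegment E a l b) : f a ≤ f b := by
  induction l generalizing a with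
  | nil => exact (congrArg f hl).le
  | cons e l ih =>
    obtain ⟨he, rfl, hl⟩ := hl
    exact (hf e he).trans (ih hl)

theorem Reads.mem_vertexSet {a b : V} {t : List X} (ht : t ≠ []) (h : Reads E a t b) :
    a ∈ vertexSet E ∧ b ∈ vertexSet E := by
  obtain ⟨l, hl, rfl⟩ := h
  have hne : l ≠ [] := fun h => ht (label_eq_nil.2 h)
  constructor
  · obtain ⟨e, l, rfl⟩ := List.exists_cons_of_ne_nil hne
    exact ⟨e, hl.1, Or.inl hl.2.1.symm⟩
  · rcases l.eq_nil_or_concat with rfl | ⟨l, e, rfl⟩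
    · exact absurd rfl hne
    · rw [List.concat_eq_append, isSegment_concat] at hl
      exact ⟨e, hl.2.1, Or.inr hl.2.2.symm⟩

theorem vertexSet_finite (h : E.Finite) : (vertexSet E).Finite := by
  refine ((h.image fun e => e.1).union (h.image fun e => e.2.2)).subset ?_
  rintro a ⟨e, he, rfl | rfl⟩
  · exact Or.inl ⟨e, he, rfl⟩
  · exact Or.inr ⟨e, he, rfl⟩

theorem lineEdges_finite (p : ℕ → V) (t : List X) : (lineEdges p t).Finite := by
  refine (Set.finite_range fun j : Fin t.length => (p j, t[j], p (j + 1))).subset ?_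
  rintro e ⟨j, hj, rfl⟩
  exact ⟨⟨j, hj⟩, rfl⟩

end Segments

/-! ### Sewn segments -/

section Sewings

variable {X : Type*}

theorem Sewing.point_of_interior (σ : Sewing X) {j : ℕ} (h₀ : 0 < j) (h : j < σ.s.length) :
    σ.point j = Vertex.sewn σ.a σ.b σ.r σ.s j := by
  simp [Sewing.point, h₀.ne', h.ne]

/-- The possible values of a point of a sewn segment. -/
theorem Sewing.point_cases (σ : Sewing X) (j : ℕ) :
    (j = 0 ∧ σ.point j = σ.a) ∨ (j = σ.s.length ∧ σ.point j = σ.b) ∨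
      σ.point j = Vertex.sewn σ.a σ.b σ.r σ.s j := by
  unfold Sewing.point
  split_ifs with h₁ h₂ <;> simp [*]

/-- The linear automaton of `w` together with the segments of `S`. -/
def sewnGraph (w : List X) (S : Set (Sewing X)) : Set (Vertex X × X × Vertex X) :=
  linearAutomaton w ∪ ⋃ σ ∈ S, σ.edges

theorem mem_sewnGraph {w : List X} {S : Set (Sewing X)} {e : Vertex X × X × Vertex X} :
    e ∈ sewnGraph w S ↔ e ∈ linearAutomaton w ∨ ∃ σ ∈ S, e ∈ σ.edges := by
  simp [sewnGraph]

/-- The name of an interior vertex records its segment and its position. Hence an edge can enter it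
only along that segment or as the last edge of a segment ending there, which `hS` excludes. -/
theorem edge_into_interior {w : List X} {S : Set (Sewing X)} (σ : Sewing X) {i : ℕ}
    (hi : i + 1 < σ.s.length) (hS : ∀ τ ∈ S, τ.b ≠ σ.point (i + 1))
    {e : Vertex X × X × Vertex X} (he : e ∈ sewnGraph w S) (heq : e.2.2 = σ.point (i + 1)) :
    e.1 = σ.point i ∧ σ.s[i]? = some e.2.1 := by
  have hp := σ.point_of_interior (Nat.succ_pos i) hi
  rcases mem_sewnGraph.1 he with ⟨j, hj, rfl⟩ | ⟨τ, hτ, j, hj, rfl⟩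
  · rw [hp] at heq
    cases heq
  · rcases τ.point_cases (j + 1) with ⟨h, -⟩ | ⟨-, h⟩ | h
    · omega
    · exact absurd (h.symm.trans heq) (hS τ hτ)
    · have h' := h.symm.trans (heq.trans hp)
      obtain ⟨a, b, r, s⟩ := τ
      obtain ⟨a', b', r', s'⟩ := σ
      simp only [Vertex.sewn.injEq] at h'
      obtain ⟨rfl, rfl, rfl, rfl, h'⟩ := h'
      obtain rfl : j = i := by omega
      exact ⟨rfl, List.getElem?_eq_getElem hj⟩

theorem edge_from_interior {w : List X} {S : Set (Sewing X)} (σ : Sewing X) {i : ℕ}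
    (h₀ : 0 < i) (hi : i < σ.s.length) (hS : ∀ τ ∈ S, τ.a ≠ σ.point i)
    {e : Vertex X × X × Vertex X} (he : e ∈ sewnGraph w S) (heq : e.1 = σ.point i) :
    e.2.2 = σ.point (i + 1) ∧ σ.s[i]? = some e.2.1 := by
  have hp := σ.point_of_interior h₀ hi
  rcases mem_sewnGraph.1 he with ⟨j, hj, rfl⟩ | ⟨τ, hτ, j, hj, rfl⟩
  · rw [hp] at heq
    cases heq
  · rcases τ.point_cases j with ⟨-, h⟩ | ⟨h, -⟩ | h
    · exact absurd (h.symm.trans heq) (hS τ hτ)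
    · omega
    · have h' := h.symm.trans (heq.trans hp)
      obtain ⟨a, b, r, s⟩ := τ
      obtain ⟨a', b', r', s'⟩ := σ
      simp only [Vertex.sewn.injEq] at h'
      obtain ⟨rfl, rfl, rfl, rfl, rfl⟩ := h'
      exact ⟨rfl, List.getElem?_eq_getElem hj⟩

/-- A word `p` that cannot be read in the graph up to an interior vertex of a segment without
further incoming edges. -/
theorem not_reads_to_interior {w p : List X} {S : Set (Sewing X)} {σ : Sewing X}
    (hS : ∀ x ∈ σ.interior, ∀ τ ∈ S, τ.b ≠ x) (hp : p <:+: σ.s → p = σ.s)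
    (ho : ∀ y, y ≠ [] → y ≠ σ.s → y <+: σ.s → ¬ y <:+ p)
    {a x : Vertex X} (hx : x ∈ σ.interior) : ¬ Reads (sewnGraph w S) a p x := by
  rintro ⟨l, hl, rfl⟩
  obtain ⟨j, h₀, hj, rfl⟩ := hx
  have hlen : (σ.s.take j).length = j := by simp [hj.le]
  rcases label_suffix_or_suffix (s := σ.s) j (fun i hi e he => edge_into_interior σ (by omega)
    (hS _ ⟨i + 1, by omega, by omega, rfl⟩) he) l hl with h | h
  · have h' := h.length_le
    -- Here `p` lies within the first `j` letters of `σ.s`, so it cannot be all of `σ.s`.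
    rw [hp (h.isInfix.trans (List.take_prefix j _).isInfix)] at h'
    omega
  · exact ho _ (by rintro h'; simp [h'] at hlen; omega) (fun h' => by rw [h'] at hlen; omega)
      (List.take_prefix j _) h

/-- A word `p` that cannot be read in the graph from an interior vertex of a segment without
further outgoing edges. -/
theorem not_reads_from_interior {w p : List X} {S : Set (Sewing X)} {σ : Sewing X}
    (hS : ∀ x ∈ σ.interior, ∀ τ ∈ S, τ.a ≠ x) (hp : p <:+: σ.s → p = σ.s)
    (ho : ∀ y, y ≠ [] → y ≠ σ.s → y <:+ σ.s → ¬ y <+: p)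
    {x b : Vertex X} (hx : x ∈ σ.interior) : ¬ Reads (sewnGraph w S) x p b := by
  rintro ⟨l, hl, rfl⟩
  obtain ⟨j, h₀, hj, rfl⟩ := hx
  have hlen : (σ.s.drop j).length = σ.s.length - j := by simp
  rcases label_prefix_or_prefix (s := σ.s) l j (fun i hi hi' e he => edge_from_interior σ
    (by omega) hi' (hS _ ⟨i, by omega, hi', rfl⟩) he) hl with h | h
  · have h' := h.length_le
    rw [hp (h.isInfix.trans (List.drop_suffix j _).isInfix)] at h'
    omega
  · exact ho _ (by rintro h'; simp [h'] at hlen; omega) (fun h' => by rw [h'] at hlen; omega)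
      (List.drop_suffix j _) h

/-- If all segments of `S` end in the linear automaton, then so does every path labelled by `r`. -/
theorem exists_concat_of_label {w r s : List X} {S : Set (Sewing X)}
    (hSs : ∀ σ ∈ S, σ.s = s) (hSb : ∀ σ ∈ S, ∃ i, σ.b = Vertex.base i)
    (hr : r ≠ []) (hrs : ¬ r <:+: s) (ho : ¬ PrefixMeetsSuffix s r)
    {a b : Vertex X} {l : List (Vertex X × X × Vertex X)}
    (hl : IsSegment (sewnGraph w S) a l b) (hlab : label l = r) :
    ∃ l' e, l = l' ++ [e] ∧ e ∈ linearAutomaton w := by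
  rcases l.eq_nil_or_concat with rfl | ⟨l, e, rfl⟩
  · exact absurd hlab.symm hr
  rw [List.concat_eq_append] at hl hlab ⊢
  refine ⟨l, e, rfl, ?_⟩
  rw [isSegment_concat] at hl
  obtain ⟨hl, he, -⟩ := hl
  rcases mem_sewnGraph.1 he with h | ⟨σ, hσ, j, hj, rfl⟩
  · exact h
  exfalso
  have key := label_suffix_or_suffix (s := σ.s) j (fun i hi e he => edge_into_interior σ
    (by omega) (fun τ hτ h => by
      obtain ⟨m, hm⟩ := hSb τ hτ
      rw [hm, σ.point_of_interior (Nat.succ_pos i) (by omega)] at h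
      cases h) he) l hl
  have hs := hSs σ hσ
  have htake : σ.s.take (j + 1) = σ.s.take j ++ [σ.s[j]] := by
    rw [List.take_add_one, List.getElem?_eq_getElem hj]; rfl
  rw [label_append] at hlab
  have hlab' : label l ++ [σ.s[j]] = r := hlab
  rcases key with ⟨t, ht⟩ | ⟨t, ht⟩
  -- The whole path stays on the segment, so `r` is a subword of `s`.
  · refine hrs (hs ▸ IsInfix.trans ?_ (List.take_prefix (j + 1) σ.s).isInfix)
    exact IsSuffix.isInfix ⟨t, by rw [htake, ← ht, ← hlab']; simp⟩
  -- The path contains the segment's initial part up to its last edge: a nonempty prefix of `s` that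
  -- is a suffix of `r`.
  · refine ho ⟨σ.s.take (j + 1), by rw [htake]; exact List.concat_ne_nil _ _, hs ▸ List.take_prefix _ _, t, ?_⟩
    rw [htake, ← hlab', ← ht]; simp

/-- If all segments of `S` start in the linear automaton, then so does every path labelled by
`r`. -/
theorem exists_cons_of_label {w r s : List X} {S : Set (Sewing X)}
    (hSs : ∀ σ ∈ S, σ.s = s) (hSa : ∀ σ ∈ S, ∃ i, σ.a = Vertex.base i)
    (hr : r ≠ []) (hrs : ¬ r <:+: s) (ho : ¬ PrefixMeetsSuffix r s)
    {a b : Vertex X} {l : List (Vertex X × X × Vertex X)}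
    (hl : IsSegment (sewnGraph w S) a l b) (hlab : label l = r) :
    ∃ e l', l = e :: l' ∧ e ∈ linearAutomaton w := by
  rcases l with _ | ⟨e, l⟩
  · exact absurd hlab.symm hr
  refine ⟨e, l, rfl, ?_⟩
  obtain ⟨he, -, hl⟩ := hl
  rcases mem_sewnGraph.1 he with h | ⟨σ, hσ, j, hj, rfl⟩
  · exact h
  exfalso
  have key := label_prefix_or_prefix (s := σ.s) l (j + 1) (fun i hi hi' e he =>
    edge_from_interior σ (by omega) hi' (fun τ hτ h => by
      obtain ⟨m, hm⟩ := hSa τ hτ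
      rw [hm, σ.point_of_interior (by omega) hi'] at h
      cases h) he) hl
  have hs := hSs σ hσ
  have hdrop := List.drop_eq_getElem_cons hj
  have hlab' : σ.s[j] :: label l = r := hlab
  rw [← List.prefix_cons_inj σ.s[j], ← List.prefix_cons_inj σ.s[j] (l₁ := σ.s.drop (j + 1)),
    ← hdrop, hlab'] at key
  rcases key with h | h
  · exact hrs (hs ▸ h.isInfix.trans (List.drop_suffix j σ.s).isInfix)
  · exact ho ⟨σ.s.drop j, hdrop ▸ List.cons_ne_nil _ _, h, hs ▸ List.drop_suffix _ _⟩

end Sewings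

/-! ### The stages -/

section Stages

variable {X : Type*}

/-- The step of the construction in which a vertex is added. -/
def Vertex.depth : Vertex X → ℕ
  | base _ => 0
  | sewn a b _ _ _ => max a.depth b.depth + 1

/-- The index of the vertex of the linear automaton that is reached from a vertex by running
through sewn segments to their ends. -/
def Vertex.right : Vertex X → ℕ
  | base i => i
  | sewn _ b _ _ _ => b.right

/-- The index of the vertex of the linear automaton that is reached from a vertex by running
through sewn segments back to their beginnings. -/
def Vertex.left : Vertex X → ℕ
  | base i => i
  | sewn a _ _ _ _ => a.left

/-- The segments sewn on in the first `n` steps. -/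
def sewingsUpTo (R : Set (List X × List X)) (w r s : List X) (k n : ℕ) : Set (Sewing X) :=
  {σ | ∃ m ≤ n, σ ∈ (stage R w r s k m).last}

variable {R : Set (List X × List X)} {w r s : List X} {k : ℕ}

theorem mem_stage_last_one {σ : Sewing X} :
    σ ∈ (stage R w r s k 1).last ↔ σ = ⟨Vertex.base k, Vertex.base (k + r.length), r, s⟩ :=
  Iff.rfl

/-! ### Stages and their limit as sewn graphs -/

theorem stage_edges_succ (n : ℕ) :
    (stage R w r s k (n + 1)).edges =
      (stage R w r s k n).edges ∪ ⋃ σ ∈ (stage R w r s k (n + 1)).last, σ.edges := by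
  cases n <;> rfl

/-- This form, and its analogue for the limit, let the same path lemmas serve both the induction
over stages and the regions of the union. -/
theorem stage_edges (n : ℕ) :
    (stage R w r s k n).edges = sewnGraph w (sewingsUpTo R w r s k n) := by
  induction n with
  | zero =>
    ext e
    have h : (stage R w r s k 0).last = ∅ := rfl
    simp only [mem_sewnGraph, sewingsUpTo, Nat.le_zero, exists_eq_left, h, Set.mem_ofPred_eq,
      Set.mem_empty_iff_false, false_and, exists_false, or_false]
    rfl
  | succ n ih =>
    ext e
    rw [stage_edges_succ, ih]
    simp only [Set.mem_union, mem_sewnGraph, Set.mem_iUnion, exists_prop, sewingsUpTo,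
      Set.mem_ofPred_eq, or_assoc]
    refine or_congr_right ⟨?_, ?_⟩
    · rintro (⟨σ, ⟨m, hm, hσ⟩, he⟩ | ⟨σ, hσ, he⟩)
      · exact ⟨σ, ⟨m, by omega, hσ⟩, he⟩
      · exact ⟨σ, ⟨n + 1, le_rfl, hσ⟩, he⟩
    · rintro ⟨σ, ⟨m, hm, hσ⟩, he⟩
      rcases Nat.lt_or_ge n m with h | h
      · obtain rfl : m = n + 1 := by omega
        exact Or.inr ⟨σ, hσ, he⟩
      · exact Or.inl ⟨σ, ⟨m, h, hσ⟩, he⟩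

theorem generatedSubgraph_eq :
    generatedSubgraph R w r s k =
      sewnGraph w {σ | ∃ m, σ ∈ (stage R w r s k m).last} := by
  ext e
  simp only [generatedSubgraph, Set.mem_iUnion, stage_edges, mem_sewnGraph, sewingsUpTo,
    Set.mem_ofPred_eq]
  constructor
  · rintro ⟨n, h | ⟨σ, ⟨m, -, hσ⟩, he⟩⟩
    · exact Or.inl h
    · exact Or.inr ⟨σ, ⟨m, hσ⟩, he⟩
  · rintro (h | ⟨σ, ⟨m, hσ⟩, he⟩)
    · exact ⟨0, Or.inl h⟩
    · exact ⟨m, Or.inr ⟨σ, ⟨m, le_rfl, hσ⟩, he⟩⟩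

theorem Sides.ne_nil (hR : ∀ ρ ∈ R, ρ.1 ≠ [] ∧ ρ.2 ≠ []) {p q : List X} (h : Sides R p q) :
    p ≠ [] ∧ q ≠ [] := by
  rcases h with h | h
  · exact hR _ h
  · exact (hR _ h).symm

/-! ### Depth and freshness of vertices -/

theorem Sewing.depth_of_interior {σ : Sewing X} {x : Vertex X} (hx : x ∈ σ.interior) :
    x.depth = max σ.a.depth σ.b.depth + 1 := by
  obtain ⟨j, h₀, hj, rfl⟩ := hx
  rw [σ.point_of_interior h₀ hj]
  rfl

theorem Sewing.depth_point_le (σ : Sewing X) (j : ℕ) :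
    (σ.point j).depth ≤ max σ.a.depth σ.b.depth + 1 := by
  rcases σ.point_cases j with ⟨-, h⟩ | ⟨-, h⟩ | h <;> rw [h]
  · omega
  · omega
  · exact le_rfl

/-- A general step uses an endpoint interior to a segment of the previous step, so one endpoint has
the maximal depth so far and the new interior vertices are exactly one deeper. Depth thus separates
fresh vertices from all endpoints used earlier. -/
theorem stage_depth (hR : ∀ ρ ∈ R, ρ.1 ≠ [] ∧ ρ.2 ≠ []) (n : ℕ) :
    (∀ x ∈ vertexSet (stage R w r s k n).edges, x.depth ≤ n) ∧
      ∀ σ ∈ (stage R w r s k n).last, max σ.a.depth σ.b.depth + 1 = n := by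
  induction n with
  | zero =>
    refine ⟨?_, fun σ h => absurd h (Set.notMem_empty σ)⟩
    rintro x ⟨e, ⟨j, hj, rfl⟩, rfl | rfl⟩ <;> exact le_rfl
  | succ n ih =>
    obtain ⟨ih₁, ih₂⟩ := ih
    have hlast : ∀ σ ∈ (stage R w r s k (n + 1)).last,
        max σ.a.depth σ.b.depth + 1 = n + 1 := by
      intro σ hσ
      rcases n with _ | n
      · rw [mem_stage_last_one] at hσ
        subst hσ
        rfl
      · obtain ⟨⟨hsides, hreads, -⟩, τ, hτ, h⟩ := hσ
        obtain ⟨ha, hb⟩ := hreads.mem_vertexSet (hsides.ne_nil hR).1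
        have ha := ih₁ _ ha
        have hb := ih₁ _ hb
        have hτ' := ih₂ τ hτ
        rcases h with h | h <;> have h := Sewing.depth_of_interior h <;> omega
    refine ⟨?_, hlast⟩
    rintro x ⟨e, he, hx⟩
    rw [stage_edges_succ] at he
    rcases he with he | he
    · exact (ih₁ x ⟨e, he, hx⟩).trans (Nat.le_succ n)
    · simp only [Set.mem_iUnion] at he
      obtain ⟨σ, hσ, j, hj, rfl⟩ := he
      rw [← hlast σ hσ]
      rcases hx with rfl | rfl
      · exact σ.depth_point_le j
      · exact σ.depth_point_le (j + 1)

/-- The interior vertices of the segments sewn on last are not endpoints of segments sewn on so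
far. -/
theorem endpoint_ne_interior (hR : ∀ ρ ∈ R, ρ.1 ≠ [] ∧ ρ.2 ≠ []) {n : ℕ} {τ : Sewing X}
    (hτ : τ ∈ (stage R w r s k n).last) {x : Vertex X} (hx : x ∈ τ.interior)
    {σ : Sewing X} (hσ : σ ∈ sewingsUpTo R w r s k n) : σ.a ≠ x ∧ σ.b ≠ x := by
  obtain ⟨m, hm, hσ⟩ := hσ
  have h₁ := (stage_depth hR m).2 σ hσ
  have h₂ := (stage_depth hR n).2 τ hτ
  have h₃ := Sewing.depth_of_interior hx
  constructor <;> rintro rfl <;> omega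

/-- Since the words read are nonempty, both endpoints of an expansion are among the finitely many
vertices of `T`. -/
theorem next_finite (hR : ∀ ρ ∈ R, ρ.1 ≠ [] ∧ ρ.2 ≠ []) (hfin : R.Finite) {T : Stage X}
    (hT : T.edges.Finite) : (T.next R).Finite := by
  have hV := vertexSet_finite hT
  have hS : {ρ : List X × List X | Sides R ρ.1 ρ.2}.Finite := by
    refine (hfin.union (hfin.image Prod.swap)).subset ?_
    rintro ⟨p, q⟩ (h | h)
    · exact Or.inl h
    · exact Or.inr ⟨_, h, rfl⟩
  refine (((hV.prod hV).prod hS).image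
    fun z => (⟨z.1.1, z.1.2, z.2.1, z.2.2⟩ : Sewing X)).subset ?_
  rintro ⟨a, b, p, q⟩ ⟨⟨h₁, h₂, -⟩, -⟩
  exact ⟨((a, b), (p, q)), ⟨h₂.mem_vertexSet (h₁.ne_nil hR).1, h₁⟩, rfl⟩

theorem stage_edges_finite (hR : ∀ ρ ∈ R, ρ.1 ≠ [] ∧ ρ.2 ≠ []) (hfin : R.Finite) (n : ℕ) :
    (stage R w r s k n).edges.Finite := by
  induction n with
  | zero => exact lineEdges_finite _ _
  | succ n ih =>
    rw [stage_edges_succ]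
    refine ih.union (Set.Finite.biUnion ?_ fun σ _ => lineEdges_finite _ _)
    rcases n with _ | n
    · exact Set.finite_singleton _
    · exact next_finite hR hfin ih

/-- If no segments are sewn on after step `N`, then the generated subgraph is finite. -/
theorem generatedSubgraph_finite (hR : ∀ ρ ∈ R, ρ.1 ≠ [] ∧ ρ.2 ≠ []) (hfin : R.Finite) (N : ℕ)
    (hN : ∀ n, ∀ σ ∈ (stage R w r s k n).last, n ≤ N) :
    (generatedSubgraph R w r s k).Finite := by
  refine (stage_edges_finite (w := w) (r := r) (s := s) (k := k) hR hfin N).subset ?_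
  rw [generatedSubgraph_eq, stage_edges]
  intro e he
  rw [mem_sewnGraph] at he ⊢
  rcases he with h | ⟨σ, ⟨m, hσ⟩, he⟩
  · exact Or.inl h
  · exact Or.inr ⟨σ, ⟨m, hN m σ hσ, hσ⟩, he⟩

end Stages

/-! ### One relation -/

section OneRelation

variable {X : Type u} {u v w r s : List X} {k : ℕ}

theorem sides_singleton {p q : List X} (h : Sides {(u, v)} r s) (h' : Sides {(u, v)} p q) :
    (p = r ∧ q = s) ∨ (p = s ∧ q = r) := by
  simp only [Sides, Set.mem_singleton_iff, Prod.mk.injEq] at h h'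
  rcases h with ⟨rfl, rfl⟩ | ⟨rfl, rfl⟩ <;> rcases h' with ⟨rfl, rfl⟩ | ⟨rfl, rfl⟩ <;> simp

theorem OccursAt.add_length_le (hr : r ≠ []) (h : OccursAt r w k) : k + r.length ≤ w.length := by
  have h₁ := IsPrefix.length_le h
  have h₂ := List.length_pos_iff.2 hr
  rw [List.length_drop] at h₁
  omega

/-! ### Progress along the linear automaton -/

theorem Sewing.right_of_interior {σ : Sewing X} {x : Vertex X} (hx : x ∈ σ.interior) :
    x.right = σ.b.right := by
  obtain ⟨j, h₀, hj, rfl⟩ := hx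
  rw [σ.point_of_interior h₀ hj]
  rfl

theorem Sewing.left_of_interior {σ : Sewing X} {x : Vertex X} (hx : x ∈ σ.interior) :
    x.left = σ.a.left := by
  obtain ⟨j, h₀, hj, rfl⟩ := hx
  rw [σ.point_of_interior h₀ hj]
  rfl

/-- On a sewn segment `right` changes at most at the first edge, from its value at `a` to its value
at `b`. Monotonicity then passes to paths and measures the progress of endpoints. -/
theorem right_le_right {S : Set (Sewing X)} (hS : ∀ σ ∈ S, σ.a.right ≤ σ.b.right)
    {e : Vertex X × X × Vertex X} (he : e ∈ sewnGraph w S) : e.1.right ≤ e.2.2.right := by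
  rcases mem_sewnGraph.1 he with ⟨j, hj, rfl⟩ | ⟨σ, hσ, j, hj, rfl⟩
  · exact Nat.le_succ j
  · have h := hS σ hσ
    have h₁ : (σ.point j).right ≤ σ.b.right := by
      rcases σ.point_cases j with ⟨-, h'⟩ | ⟨-, h'⟩ | h' <;> rw [h']
      · exact h
      · exact le_rfl
    have h₂ : (σ.point (j + 1)).right = σ.b.right := by
      rcases σ.point_cases (j + 1) with ⟨h', -⟩ | ⟨-, h'⟩ | h'
      · omega
      · rw [h']
      · rw [h']; rfl
    exact h₁.trans h₂.ge

theorem left_le_left {S : Set (Sewing X)} (hS : ∀ σ ∈ S, σ.a.left ≤ σ.b.left)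
    {e : Vertex X × X × Vertex X} (he : e ∈ sewnGraph w S) : e.1.left ≤ e.2.2.left := by
  rcases mem_sewnGraph.1 he with ⟨j, hj, rfl⟩ | ⟨σ, hσ, j, hj, rfl⟩
  · exact Nat.le_succ j
  · have h := hS σ hσ
    have h₁ : (σ.point j).left = σ.a.left := by
      rcases σ.point_cases j with ⟨-, h'⟩ | ⟨h', -⟩ | h'
      · rw [h']
      · omega
      · rw [h']; rfl
    have h₂ : σ.a.left ≤ (σ.point (j + 1)).left := by
      rcases σ.point_cases (j + 1) with ⟨-, h'⟩ | ⟨-, h'⟩ | h' <;> rw [h']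
      · exact h
      · exact le_rfl
    exact h₁.le.trans h₂

/-- If no prefix of `s` is a suffix of `r`, then only segments labelled by `s` are sewn on, and
they end at vertices of the linear automaton which move to the right with every step. -/
theorem stage_last_of_not_prefixMeetsSuffix_left
    (hR : ∀ ρ ∈ ({(u, v)} : Set (List X × List X)), ρ.1 ≠ [] ∧ ρ.2 ≠ [])
    (hsides : Sides {(u, v)} r s) (hrs : ¬ r <:+: s) (hs : ¬ OverlapsItself s)
    (ho : ¬ PrefixMeetsSuffix s r) (hk : OccursAt r w k) (n : ℕ) :
    ∀ σ ∈ (stage {(u, v)} w r s k n).last, σ.r = r ∧ σ.s = s ∧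
      ∃ i, σ.b = Vertex.base i ∧ i ≤ w.length ∧ σ.a.right < i ∧ n ≤ i := by
  induction n using Nat.strong_induction_on with
  | _ n ih =>
  have hr := (hsides.ne_nil hR).1
  intro σ hσ
  rcases n with _ | _ | n
  · exact absurd hσ (Set.notMem_empty σ)
  · rw [mem_stage_last_one] at hσ
    subst hσ
    have h := List.length_pos_iff.2 hr
    refine ⟨rfl, rfl, _, rfl, hk.add_length_le hr, ?_, by omega⟩
    change k < k + r.length
    omega
  · obtain ⟨⟨hsides', hreads, -⟩, τ, hτ, h⟩ := hσ
    rw [stage_edges] at hreads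
    obtain ⟨-, hτs, iτ, hτb, -, -, hτn⟩ := ih (n + 1) (by omega) τ hτ
    have hS : ∀ ρ ∈ sewingsUpTo {(u, v)} w r s k (n + 1), ρ.s = s ∧
        ∃ i, ρ.b = Vertex.base i ∧ ρ.a.right < i := by
      rintro ρ ⟨m, hm, hρ⟩
      obtain ⟨-, h₁, i, h₂, -, h₃, -⟩ := ih m (by omega) ρ hρ
      exact ⟨h₁, i, h₂, h₃⟩
    -- No segment ends at a fresh interior vertex, so neither side of the relation can be read up to
    -- it.
    have hb : σ.b ∉ τ.interior := by
      intro hb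
      refine not_reads_to_interior (p := σ.r)
        (fun x hx ρ hρ => (endpoint_ne_interior hR hτ hx hρ).2) ?_ ?_ hb hreads
      · rw [hτs]
        rcases sides_singleton hsides hsides' with ⟨h, -⟩ | ⟨h, -⟩ <;> rw [h]
        · exact fun h => absurd h hrs
        · exact fun _ => rfl
      · intro y hy hys hyp hyq
        rw [hτs] at hys hyp
        rcases sides_singleton hsides hsides' with ⟨h, -⟩ | ⟨h, -⟩ <;> rw [h] at hyq
        · exact ho ⟨y, hy, hyp, hyq⟩
        · exact hs ⟨y, hy, hys, hyp, hyq⟩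
    have ha : σ.a ∈ τ.interior := h.resolve_right hb
    -- Reading `s` from inside a segment labelled `s` would produce a self-overlap.
    have hσr : σ.r = r ∧ σ.s = s := by
      refine (sides_singleton hsides hsides').resolve_right fun h' => ?_
      rw [h'.1] at hreads
      refine not_reads_from_interior
        (fun x hx ρ hρ => (endpoint_ne_interior hR hτ hx hρ).1) ?_ ?_ ha hreads
      · rw [hτs]; exact fun _ => rfl
      · rw [hτs]
        exact fun y hy hys hyq hyp => hs ⟨y, hy, hys, hyp, hyq⟩
    refine ⟨hσr.1, hσr.2, ?_⟩
    rw [hσr.1] at hreads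
    obtain ⟨l, hl, hlab⟩ := hreads
    obtain ⟨l, e, rfl, j, hj, rfl⟩ := exists_concat_of_label (fun ρ hρ => (hS ρ hρ).1)
      (fun ρ hρ => let ⟨i, hi, _⟩ := (hS ρ hρ).2; ⟨i, hi⟩) hr hrs ho hl hlab
    rw [isSegment_concat] at hl
    obtain ⟨hl, -, hb'⟩ := hl
    have hle := hl.le_of_edges (f := Vertex.right) fun e he => right_le_right (fun ρ hρ => by
      obtain ⟨-, i, h₁, h₂⟩ := hS ρ hρ
      rw [h₁]
      exact h₂.le) he
    have hle' : σ.a.right ≤ j := hle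
    have hτr := Sewing.right_of_interior ha
    rw [hτb] at hτr
    have hτr' : σ.a.right = iτ := hτr
    -- The final edge runs from `base j` to `base (j + 1)`, and `iτ ≤ j` by monotonicity; with `n +
    -- 1 ≤ iτ` this gives the bound for step `n + 2`.
    exact ⟨j + 1, hb'.symm, hj, by omega, by omega⟩

/-- If no prefix of `r` is a suffix of `s`, then only segments labelled by `s` are sewn on, and
they start at vertices of the linear automaton which move to the left with every step. -/
theorem stage_last_of_not_prefixMeetsSuffix_right
    (hR : ∀ ρ ∈ ({(u, v)} : Set (List X × List X)), ρ.1 ≠ [] ∧ ρ.2 ≠ [])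
    (hsides : Sides {(u, v)} r s) (hrs : ¬ r <:+: s) (hs : ¬ OverlapsItself s)
    (ho : ¬ PrefixMeetsSuffix r s) (n : ℕ) :
    ∀ σ ∈ (stage {(u, v)} w r s k n).last, σ.r = r ∧ σ.s = s ∧
      ∃ i, σ.a = Vertex.base i ∧ i < σ.b.left ∧ i + n ≤ k + 1 := by
  induction n using Nat.strong_induction_on with
  | _ n ih =>
  have hr := (hsides.ne_nil hR).1
  intro σ hσ
  rcases n with _ | _ | n
  · exact absurd hσ (Set.notMem_empty σ)
  · rw [mem_stage_last_one] at hσ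
    subst hσ
    have h := List.length_pos_iff.2 hr
    -- The bound is an equality here: the first segment starts at `base k` in step 1.
    refine ⟨rfl, rfl, _, rfl, ?_, le_rfl⟩
    change k < k + r.length
    omega
  · obtain ⟨⟨hsides', hreads, -⟩, τ, hτ, h⟩ := hσ
    rw [stage_edges] at hreads
    obtain ⟨-, hτs, iτ, hτa, -, hτn⟩ := ih (n + 1) (by omega) τ hτ
    have hS : ∀ ρ ∈ sewingsUpTo {(u, v)} w r s k (n + 1), ρ.s = s ∧
        ∃ i, ρ.a = Vertex.base i ∧ i < ρ.b.left := by
      rintro ρ ⟨m, hm, hρ⟩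
      obtain ⟨-, h₁, i, h₂, h₃, -⟩ := ih m (by omega) ρ hρ
      exact ⟨h₁, i, h₂, h₃⟩
    have ha : σ.a ∉ τ.interior := by
      intro ha
      refine not_reads_from_interior (p := σ.r)
        (fun x hx ρ hρ => (endpoint_ne_interior hR hτ hx hρ).1) ?_ ?_ ha hreads
      · rw [hτs]
        rcases sides_singleton hsides hsides' with ⟨h, -⟩ | ⟨h, -⟩ <;> rw [h]
        · exact fun h => absurd h hrs
        · exact fun _ => rfl
      · intro y hy hys hyp hyq
        rw [hτs] at hys hyp
        rcases sides_singleton hsides hsides' with ⟨h, -⟩ | ⟨h, -⟩ <;> rw [h] at hyq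
        · exact ho ⟨y, hy, hyq, hyp⟩
        · exact hs ⟨y, hy, hys, hyq, hyp⟩
    have hb : σ.b ∈ τ.interior := h.resolve_left ha
    have hσr : σ.r = r ∧ σ.s = s := by
      refine (sides_singleton hsides hsides').resolve_right fun h' => ?_
      rw [h'.1] at hreads
      refine not_reads_to_interior
        (fun x hx ρ hρ => (endpoint_ne_interior hR hτ hx hρ).2) ?_ ?_ hb hreads
      · rw [hτs]; exact fun _ => rfl
      · rw [hτs]
        exact fun y hy hys hyp hyq => hs ⟨y, hy, hys, hyp, hyq⟩
    refine ⟨hσr.1, hσr.2, ?_⟩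
    rw [hσr.1] at hreads
    obtain ⟨l, hl, hlab⟩ := hreads
    obtain ⟨e, l, rfl, j, hj, rfl⟩ := exists_cons_of_label (fun ρ hρ => (hS ρ hρ).1)
      (fun ρ hρ => let ⟨i, hi, _⟩ := (hS ρ hρ).2; ⟨i, hi⟩) hr hrs ho hl hlab
    obtain ⟨-, ha', hl⟩ := hl
    have hle := hl.le_of_edges (f := Vertex.left) fun e he => left_le_left (fun ρ hρ => by
      obtain ⟨-, i, h₁, h₂⟩ := hS ρ hρ
      rw [h₁]
      exact h₂.le) he
    have hle' : j + 1 ≤ σ.b.left := hle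
    have hτl := Sewing.left_of_interior hb
    rw [hτa] at hτl
    have hτl' : σ.b.left = iτ := hτl
    -- The first edge lies on the line and the rest starts at `base (j + 1)`, so `j + 1 ≤ iτ`: each
    -- step moves the start left by at least one.
    exact ⟨j, ha'.symm, by omega, by omega⟩

/-- With a single relation, one of the two sides of any region is labelled `r`, so only paths
labelled `r` need to be examined. -/
theorem Region.usesEdgeOf_of_label {V : Type u} {E L : Set (V × X × V)}
    (hsides : Sides {(u, v)} r s)
    (h : ∀ a b l, IsSegment E a l b → label l = r → ∃ e ∈ L, e ∈ l)
    (D : Region {(u, v)} E) : D.UsesEdgeOf L := by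
  have hrel : Sides {(u, v)} D.rel.1 D.rel.2 := Or.inl D.rel_mem
  rcases sides_singleton hsides hrel with ⟨h₁, -⟩ | ⟨-, h₂⟩
  · obtain ⟨e, he, hl⟩ := h _ _ _ D.isSegment₁ (D.label₁.trans h₁)
    exact ⟨e, he, Or.inl hl⟩
  · obtain ⟨e, he, hl⟩ := h _ _ _ D.isSegment₂ (D.label₂.trans h₂)
    exact ⟨e, he, Or.inr hl⟩

theorem regions_and_finite
    (hR : ∀ ρ ∈ ({(u, v)} : Set (List X × List X)), ρ.1 ≠ [] ∧ ρ.2 ≠ [])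
    (hsides : Sides {(u, v)} r s) (hrs : ¬ r <:+: s) (hs : ¬ OverlapsItself s)
    (ho : ¬ PrefixMeetsSuffix s r ∨ ¬ PrefixMeetsSuffix r s) (hk : OccursAt r w k) :
    (∀ D : Region {(u, v)} (generatedSubgraph {(u, v)} w r s k),
      D.UsesEdgeOf (linearAutomaton w)) ∧ (generatedSubgraph {(u, v)} w r s k).Finite := by
  have hr := (hsides.ne_nil hR).1
  rcases ho with ho | ho
  · have hlast := stage_last_of_not_prefixMeetsSuffix_left hR hsides hrs hs ho hk
    constructor
    · refine Region.usesEdgeOf_of_label hsides fun a b l hl hlab => ?_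
      rw [generatedSubgraph_eq] at hl
      obtain ⟨l', e, rfl, he⟩ := exists_concat_of_label
        (by rintro σ ⟨m, hσ⟩; exact (hlast m σ hσ).2.1)
        (by rintro σ ⟨m, hσ⟩; obtain ⟨-, -, i, hi, -⟩ := hlast m σ hσ; exact ⟨i, hi⟩)
        hr hrs ho hl hlab
      exact ⟨e, he, by simp⟩
    · refine generatedSubgraph_finite hR (Set.finite_singleton _) w.length fun n σ hσ => ?_
      obtain ⟨-, -, i, -, h₁, -, h₂⟩ := hlast n σ hσ
      -- `n ≤ i ≤ w.length` bounds the number of steps.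
      omega
  · have hlast := stage_last_of_not_prefixMeetsSuffix_right (w := w) (k := k) hR hsides hrs hs ho
    constructor
    · refine Region.usesEdgeOf_of_label hsides fun a b l hl hlab => ?_
      rw [generatedSubgraph_eq] at hl
      obtain ⟨e, l', rfl, he⟩ := exists_cons_of_label
        (by rintro σ ⟨m, hσ⟩; exact (hlast m σ hσ).2.1)
        (by rintro σ ⟨m, hσ⟩; obtain ⟨-, -, i, hi, -⟩ := hlast m σ hσ; exact ⟨i, hi⟩)
        hr hrs ho hl hlab
      exact ⟨e, he, by simp⟩
    · refine generatedSubgraph_finite hR (Set.finite_singleton _) (k + 1) fun n σ hσ => ?_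
      obtain ⟨-, -, i, -, -, h₂⟩ := hlast n σ hσ
      omega

end OneRelation

end RWordSubgraph

theorem propositionP9 {X : Type*} (u v : List X)
    (hAdian : RWordSubgraph.IsAdian {(u, v)})
    (hType : RWordSubgraph.IsTypeThree u v)
    (hu : ¬ RWordSubgraph.OverlapsItself u) (hv : ¬ RWordSubgraph.OverlapsItself v)
    (w : List X) (r s : List X) (hrs : RWordSubgraph.Sides {(u, v)} r s)
    (k : ℕ) (hk : RWordSubgraph.OccursAt r w k) :
    (∀ D : RWordSubgraph.Region {(u, v)}
        (RWordSubgraph.generatedSubgraph {(u, v)} w r s k),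
      D.UsesEdgeOf (RWordSubgraph.linearAutomaton w)) ∧
    (RWordSubgraph.vertexSet
        (RWordSubgraph.generatedSubgraph {(u, v)} w r s k)).Finite ∧
    (RWordSubgraph.generatedSubgraph {(u, v)} w r s k).Finite := by
  obtain ⟨⟨huv, hvu⟩, ho⟩ := hType
  suffices h : ¬ r <:+: s ∧ ¬ RWordSubgraph.OverlapsItself s ∧
      (¬ RWordSubgraph.PrefixMeetsSuffix s r ∨ ¬ RWordSubgraph.PrefixMeetsSuffix r s) by
    obtain ⟨h₁, h₂⟩ := RWordSubgraph.regions_and_finite hAdian.positive hrs h.1 h.2.1 h.2.2 hk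
    exact ⟨h₁, RWordSubgraph.vertexSet_finite h₂, h₂⟩
  -- The assumptions are symmetric in `u` and `v`; exchanging them only swaps the two overlap
  -- alternatives.
  rcases RWordSubgraph.sides_singleton (Or.inl rfl) hrs with ⟨rfl, rfl⟩ | ⟨rfl, rfl⟩
  · exact ⟨huv, hv, ho.imp And.right And.right⟩
  · exact ⟨hvu, hu, ho.symm.imp And.right And.right⟩
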